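/- For signed exponents $s_1,\dots,s_r$ (a bar over $s_j$ means that the sign $(-1)^{k_j}$ is attached to the summation index $k_j$) let $\zeta(s_1,\dots,s_r)=\lim_{n\to\infty}\sum_{n\ge k_1>\cdots>k_r\ge 1}\prod_{j=1}^r \frac{\varepsilon_j^{k_j}}{k_j^{s_j}}$, where $\varepsilon_j=-1$ if $s_j$ is barred and $\varepsilon_j=1$ otherwise; $\{1\}_a$ denotes $a$ consecutive unbarred arguments $1$. Let $\zeta(s)$ be the Riemann zeta function and $\mathrm{Li}_p(x)=\sum_{n\ge1}x^n/n^p$. For every integer $m\ge 1$ the limit defining $\zeta(\bar 1,\{1\}_{m-1},\bar 1)$ exists. One has $$\zeta(\bar 1,\bar 1)=\tfrac12\left(\ln^2 2-\zeta(2)\right),$$ and for every integer $m\ge 2$ the recurrence $$\begin{aligned}\zeta(\bar 1,\{1\}_{m-1},\bar 1)={}&\frac{\ln^{m+1}2}{m!}-\frac{\zeta(2)\ln^{m-1}2}{(m-1)!}-\sum_{i=1}^{m-1}\frac{(\ln 2)^i}{i!}\,\zeta(\bar 1,\{1\}_{m-i-1},\bar 1)\\&-\frac{1}{(m-1)!}\sum_{k=1}^{m-1}\binom{m-1}{k}(-1)^{k+1}\left\{\sum_{l=1}^{k}l!\binom{k}{l}(\ln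 2)^{m-l-1}\mathrm{Li}_{l+2}\!\left(\tfrac12\right)-k!\,(\ln 2)^{m-k-1}\zeta(k+2)\right\}.\end{aligned}$$ Hence, for every $m\ge1$, $\zeta(\bar 1,\{1\}_{m-1},\bar 1)$ is a polynomial with rational coefficients in $\ln 2$, the zeta values $\zeta(j)$ and the polylogarithm values $\mathrm{Li}_j(1/2)$ with $2\le j\le m+1$. -/

import Mathlib

open Filter Topology

/-- One argument of an alternating multiple zeta value: the exponent `s ≥ 1`, together with a flag
saying whether it carries a bar, i.e. whether the sign `(-1) ^ k` is attached to its index `k`. -/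
structure ZetaArg where
  exponent : ℕ
  barred : Bool

/-- The factor `1 / k ^ s` (unbarred argument) or `(-1) ^ k / k ^ s` (barred argument). -/
noncomputable def ZetaArg.factor (a : ZetaArg) (k : ℕ) : ℝ :=
  (if a.barred then (-1 : ℝ) ^ k else 1) / (k : ℝ) ^ a.exponent

/-- The (alternating) multiple harmonic number
`ζ_n(s₁, …, s_r) = ∑_{n ≥ k₁ > k₂ > ⋯ > k_r ≥ 1} ∏_j (±1) ^ {k_j} / k_j ^ {s_j}`,
as a nested sum whose outermost (largest) index `k₁` belongs to the first argument;
`ζ_n(∅) = 1`. -/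
noncomputable def multipleHarmonic : List ZetaArg → ℕ → ℝ
  | [], _ => 1
  | a :: s, n => ∑ k ∈ Finset.Icc 1 n, a.factor k * multipleHarmonic s (k - 1)

/-- The (alternating) multiple zeta value `ζ(s₁, …, s_r) = lim_{n → ∞} ζ_n(s₁, …, s_r)`. -/
noncomputable def multipleZeta (s : List ZetaArg) : ℝ :=
  limUnder atTop (multipleHarmonic s)

/-- The argument string `(1̄, {1}_a, 1̄)`, with `a` unbarred ones in the middle. -/
def barOnesBar (a : ℕ) : List ZetaArg :=
  ⟨1, true⟩ :: (List.replicate a ⟨1, false⟩ ++ [⟨1, true⟩])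

/-- The value `ζ(s)` of the Riemann zeta function at a natural number, as a real number. -/
noncomputable def zetaNat (s : ℕ) : ℝ := (riemannZeta (s : ℂ)).re

/-- The polylogarithm `Li_p(x) = ∑_{n ≥ 1} x ^ n / n ^ p`. -/
noncomputable def polylog (p : ℕ) (x : ℝ) : ℝ :=
  ∑' n : ℕ, x ^ (n + 1) / ((n + 1 : ℕ) : ℝ) ^ p

/-! The value is found in closed form by generating functions. With `altGen m` the power series of
the summands of `ζ_n({1}_m, 1̄)`, multiplying by `1 - y` turns partial sums back into summands, so
`altGen (m + 1)` has derivative `altGen m y / (1 - y)`. Put `y = -x` and `p = (1 + x) / 2`: the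
kernel becomes `-dp / p` and `altGen 0` becomes `-log (2 * (1 - p))`, which is `Li_1(p)` up to a
constant. Iterated integration from `p = 1/2` therefore produces polylogarithms of `p` and powers of
`log (2 * p)` (`altGen_neg_eq_altClosed`).

The wanted series is the boundary value at `x = 1`. It converges by summation by parts
(`exists_tendsto_sum_altCoeff`), so Abel's theorem identifies its sum with the limit of the closed
form (`tendsto_sum_altCoeff`), namely `barOnesBarValue`.

The recurrence is then pure algebra (`sum_range_recurrence`): convolving the closed form with `(ln
2)^i / i!` and using alternating binomial sums removes `Li_2(1/2)`. The initial value comes instead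
from squaring `ζ_n(1̄)`. -/

/-! ### Partial sums and crude bounds -/

/-- The multiple harmonic number `ζ_n({1}_m, 1̄)`. -/
noncomputable def altSum (m n : ℕ) : ℝ :=
  multipleHarmonic (List.replicate m ⟨1, false⟩ ++ [⟨1, true⟩]) n

/-- The summand of `ζ_n({1}_m, 1̄)` with outermost index `n`. -/
noncomputable def altCoeff : ℕ → ℕ → ℝ
  | 0, n => (-1) ^ n / n
  | m + 1, n => altSum m (n - 1) / n

theorem altSum_eq_sum (m n : ℕ) : altSum m n = ∑ k ∈ Finset.Icc 1 n, altCoeff m k := by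
  cases m with
  | zero => simp [altSum, multipleHarmonic, altCoeff, ZetaArg.factor]
  | succ m =>
    simp only [altSum, List.replicate_succ, List.cons_append, multipleHarmonic, altCoeff,
      ZetaArg.factor]
    refine Finset.sum_congr rfl fun k _ => ?_
    simp
    ring

theorem altSum_zero_right (m : ℕ) : altSum m 0 = 0 := by simp [altSum_eq_sum]

theorem altSum_succ_right (m n : ℕ) :
    altSum m (n + 1) = altSum m n + altCoeff m (n + 1) := by
  rw [altSum_eq_sum, altSum_eq_sum, Finset.sum_Icc_succ_top (by omega)]

theorem altCoeff_succ_succ (m n : ℕ) :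
    altCoeff (m + 1) (n + 1) = altSum m n / ((n : ℝ) + 1) := by
  simp [altCoeff]

theorem multipleHarmonic_barOnesBar (m n : ℕ) :
    multipleHarmonic (barOnesBar m) n =
      ∑ k ∈ Finset.range (n + 1), (-1) ^ k * altCoeff (m + 1) k := by
  -- The added index `k = 0` contributes nothing, because division by zero gives `0`.
  rw [Finset.range_eq_Ico, Finset.sum_eq_sum_Ico_succ_bot (by omega)]
  simp only [barOnesBar, multipleHarmonic, altCoeff, ZetaArg.factor]
  simp only [altSum]
  have : Finset.Ico (0 + 1) (n + 1) = Finset.Icc 1 n := by ext; simp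
  rw [this]
  simp
  refine Finset.sum_congr rfl fun k _ => ?_
  ring

theorem abs_altSum_le_of_abs_altCoeff_le {m : ℕ} (h : ∀ n, |altCoeff m (n + 1)| ≤ 1) (n : ℕ) :
    |altSum m n| ≤ n := by
  induction n with
  | zero => simp [altSum_zero_right]
  | succ n ih =>
    rw [altSum_succ_right]
    push_cast
    exact (abs_add_le _ _).trans (add_le_add ih (h n))

theorem abs_altCoeff_le_one (m n : ℕ) : |altCoeff m (n + 1)| ≤ 1 := by
  induction m generalizing n with
  | zero =>
    simp only [altCoeff, abs_div, abs_pow, abs_neg, abs_one, one_pow]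
    rw [div_le_one (by positivity)]
    push_cast
    rw [abs_of_nonneg (by positivity)]
    linarith [Nat.cast_nonneg (α := ℝ) n]
  | succ m ih =>
    rw [altCoeff_succ_succ, abs_div, abs_of_pos (a := (n : ℝ) + 1) (by positivity),
      div_le_one (by positivity)]
    linarith [abs_altSum_le_of_abs_altCoeff_le ih n]

theorem abs_altSum_le (m n : ℕ) : |altSum m n| ≤ n :=
  abs_altSum_le_of_abs_altCoeff_le (abs_altCoeff_le_one m) n

/-! ### Convergence -/

/-- Dirichlet's test for bounded variation: averaging the alternating sum with its shift by one
index leaves an absolutely convergent series and a vanishing boundary term. No monotonicity is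
needed. -/
theorem tendsto_sum_neg_one_pow_mul {b : ℕ → ℝ} (hb : Tendsto b atTop (𝓝 0))
    (hv : Summable fun n => |b n - b (n + 1)|) :
    ∃ l, Tendsto (fun n => ∑ k ∈ Finset.range n, (-1) ^ k * b k) atTop (𝓝 l) := by
  have key : ∀ n, ∑ k ∈ Finset.range n, (-1) ^ k * b k =
      (∑ k ∈ Finset.range n, (-1) ^ k * (b k - b (k + 1)) + b 0 - (-1) ^ n * b n) / 2 := by
    intro n
    induction n with
    | zero => simp
    | succ n ih =>
      rw [Finset.sum_range_succ, Finset.sum_range_succ, ih]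
      ring
  have h1 : Summable fun k => (-1 : ℝ) ^ k * (b k - b (k + 1)) := by
    refine Summable.of_abs (hv.congr fun k => ?_)
    simp [abs_mul]
  have h2 : Tendsto (fun n => (-1 : ℝ) ^ n * b n) atTop (𝓝 0) := by
    rw [tendsto_zero_iff_abs_tendsto_zero] at hb ⊢
    refine hb.congr fun k => ?_
    simp [abs_mul]
  refine ⟨_, ((h1.hasSum.tendsto_sum_nat.add_const (b 0)).sub h2 |>.div_const 2).congr
    fun n => (key n).symm⟩

theorem abs_altSum_le_log_pow (m : ℕ) (n : ℕ) :
    |altSum m n| ≤ (1 + Real.log n) ^ (m + 1) := by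
  have hH : ∀ n : ℕ, (∑ k ∈ Finset.Icc 1 n, (1 : ℝ) / k) ≤ 1 + Real.log n := by
    intro n
    have := harmonic_le_one_add_log n
    rw [harmonic_eq_sum_Icc] at this
    simpa using this
  induction m generalizing n with
  | zero =>
    rw [altSum_eq_sum]
    refine (Finset.abs_sum_le_sum_abs _ _).trans ?_
    simpa [altCoeff, abs_div] using hH n
  | succ m ih =>
    rw [altSum_eq_sum]
    have hn : (0 : ℝ) ≤ 1 + Real.log n := by
      linarith [Real.log_natCast_nonneg n]
    calc |∑ k ∈ Finset.Icc 1 n, altCoeff (m + 1) k|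
        ≤ ∑ k ∈ Finset.Icc 1 n, |altCoeff (m + 1) k| := Finset.abs_sum_le_sum_abs _ _
      _ ≤ ∑ k ∈ Finset.Icc 1 n, (1 + Real.log n) ^ (m + 1) * (1 / k) := by
        refine Finset.sum_le_sum fun k hk => ?_
        rw [Finset.mem_Icc] at hk
        have hk0 : (0 : ℝ) < k := by exact_mod_cast hk.1
        simp only [altCoeff, abs_div, Nat.abs_cast]
        rw [mul_one_div]
        refine div_le_div_of_nonneg_right ((ih (k - 1)).trans ?_) hk0.le
        have h0 := Real.log_natCast_nonneg (k - 1)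
        refine pow_le_pow_left₀ (by linarith) ?_ _
        rcases Nat.eq_zero_or_pos (k - 1) with h | h
        · rw [h]; simp; exact Real.log_natCast_nonneg n
        · have : Real.log ((k - 1 : ℕ) : ℝ) ≤ Real.log n :=
            Real.log_le_log (by exact_mod_cast h) (by exact_mod_cast (by omega))
          linarith
      _ = (1 + Real.log n) ^ (m + 1) * ∑ k ∈ Finset.Icc 1 n, (1 : ℝ) / k := by
        rw [Finset.mul_sum]
      _ ≤ _ := by
        rw [pow_succ _ (m + 1)]
        exact mul_le_mul_of_nonneg_left (hH n) (by positivity)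

/-- Any exponent strictly between 0 and 1 would serve: `altSum m n / n` then tends to zero and
`altSum m n / n ^ 2` is summable. -/
theorem altSum_isBigO (m : ℕ) :
    (fun n : ℕ => altSum m n) =O[atTop] fun n : ℕ => (n : ℝ) ^ (1 / 2 : ℝ) := by
  have h1 : (fun x : ℝ => 1 + Real.log x) =O[atTop] Real.log := by
    refine Asymptotics.IsBigO.add ?_ (Asymptotics.isBigO_refl _ _)
    exact (Real.isLittleO_const_log_atTop).isBigO
  have h2 : (fun x : ℝ => (1 + Real.log x) ^ (m + 1)) =O[atTop] fun x => x ^ (1 / 2 : ℝ) := by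
    refine (h1.pow (m + 1)).trans ?_
    have := isLittleO_log_rpow_rpow_atTop (s := 1 / 2) ((m + 1 : ℕ) : ℝ) (by norm_num)
    refine (this.congr_left fun x => ?_).isBigO
    rw [Real.rpow_natCast]
  refine Asymptotics.IsBigO.trans ?_ (h2.comp_tendsto tendsto_natCast_atTop_atTop)
  refine Asymptotics.IsBigO.of_bound 1 (Eventually.of_forall fun n => ?_)
  rw [one_mul, Real.norm_eq_abs]
  exact (abs_altSum_le_log_pow m n).trans (le_abs_self _)

theorem tendsto_altCoeff_succ (m : ℕ) : Tendsto (altCoeff (m + 1)) atTop (𝓝 0) := by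
  rw [← tendsto_add_atTop_iff_nat 1]
  simp only [altCoeff_succ_succ]
  have h : (fun n : ℕ => altSum m n / ((n : ℝ) + 1)) =O[atTop]
      fun n : ℕ => (n : ℝ) ^ (-(1 / 2) : ℝ) := by
    have h1 : (fun n : ℕ => ((n : ℝ) + 1)⁻¹) =O[atTop] fun n : ℕ => ((n : ℝ))⁻¹ := by
      refine Asymptotics.IsBigO.of_bound 1 ?_
      filter_upwards [eventually_gt_atTop 0] with n hn
      have : (0 : ℝ) < n := by exact_mod_cast hn
      rw [one_mul, Real.norm_of_nonneg (by positivity), Real.norm_of_nonneg (by positivity)]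
      gcongr
      linarith
    refine ((altSum_isBigO m).mul h1).congr' (Eventually.of_forall fun n => rfl) ?_
    filter_upwards [eventually_gt_atTop 0] with n hn
    have : (0 : ℝ) < n := by exact_mod_cast hn
    rw [← Real.rpow_neg_one, ← Real.rpow_add this]
    norm_num
  refine h.trans_tendsto ?_
  exact (tendsto_rpow_neg_atTop (by norm_num)).comp tendsto_natCast_atTop_atTop

theorem summable_abs_altSum_div (m : ℕ) :
    Summable fun n : ℕ => |altSum m n| / ((n : ℝ) + 1) / ((n : ℝ) + 1) := by
  have hs : Summable fun n : ℕ => (n : ℝ) ^ (-(3 / 2) : ℝ) := by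
    rw [Real.summable_nat_rpow]; norm_num
  refine summable_of_isBigO_nat hs ?_
  have h1 : (fun n : ℕ => (((n : ℝ) + 1)⁻¹ * ((n : ℝ) + 1)⁻¹)) =O[atTop]
      fun n : ℕ => ((n : ℝ))⁻¹ * (n : ℝ)⁻¹ := by
    refine Asymptotics.IsBigO.of_bound 1 ?_
    filter_upwards [eventually_gt_atTop 0] with n hn
    have : (0 : ℝ) < n := by exact_mod_cast hn
    rw [one_mul, Real.norm_of_nonneg (by positivity), Real.norm_of_nonneg (by positivity)]
    gcongr <;> linarith
  refine ((altSum_isBigO m).abs_left.mul h1).congr' (Eventually.of_forall fun n => ?_) ?_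
  · simp only [div_eq_mul_inv, mul_assoc]
  · filter_upwards [eventually_gt_atTop 0] with n hn
    have : (0 : ℝ) < n := by exact_mod_cast hn
    rw [← Real.rpow_neg_one, ← Real.rpow_add this, ← Real.rpow_add this]
    norm_num

theorem summable_abs_altCoeff_div (m : ℕ) :
    Summable fun n : ℕ => |altCoeff m (n + 1)| / ((n : ℝ) + 1) := by
  cases m with
  | zero =>
    have := (summable_nat_add_iff 1).2 (Real.summable_one_div_nat_pow (p := 2).2 (by norm_num))
    refine this.congr fun n => ?_
    have h : (0 : ℝ) < (n : ℝ) + 1 := by positivity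
    simp [altCoeff, abs_div, abs_of_pos h]
    field_simp
  | succ m =>
    refine (summable_abs_altSum_div m).congr fun n => ?_
    have h : (0 : ℝ) < (n : ℝ) + 1 := by positivity
    rw [altCoeff_succ_succ, abs_div, abs_of_pos h]

theorem summable_abs_altCoeff_sub (m : ℕ) :
    Summable fun n => |altCoeff (m + 1) n - altCoeff (m + 1) (n + 1)| := by
  rw [← summable_nat_add_iff 1]
  refine Summable.of_nonneg_of_le (fun _ => abs_nonneg _) (fun n => ?_)
    ((summable_abs_altSum_div m).add (summable_abs_altCoeff_div m))
  have h : (0 : ℝ) < (n : ℝ) + 1 := by positivity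
  have h2 : (0 : ℝ) < (n : ℝ) + 1 + 1 := by positivity
  rw [altCoeff_succ_succ, altCoeff_succ_succ, altSum_succ_right]
  push_cast
  -- The variation splits into the change of the denominator and the change of the numerator, each
  -- absolutely summable.
  have e : altSum m n / ((n : ℝ) + 1) - (altSum m n + altCoeff m (n + 1)) / ((n : ℝ) + 1 + 1) =
      altSum m n / ((n : ℝ) + 1) / ((n : ℝ) + 1 + 1) - altCoeff m (n + 1) / ((n : ℝ) + 1 + 1) := by
    field_simp
    ring
  rw [e]
  refine (abs_sub _ _).trans ?_
  rw [abs_div, abs_div, abs_div, abs_of_pos h, abs_of_pos h2]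
  gcongr <;> linarith

theorem exists_tendsto_sum_altCoeff (m : ℕ) :
    ∃ l, Tendsto (fun n => ∑ k ∈ Finset.range n, (-1) ^ k * altCoeff (m + 1) k) atTop (𝓝 l) :=
  tendsto_sum_neg_one_pow_mul (tendsto_altCoeff_succ m) (summable_abs_altCoeff_sub m)

/-! ### Power series -/

theorem summable_mul_pow_of_abs_le {a : ℕ → ℝ} (ha : ∀ n, |a n| ≤ n + 1) {x : ℝ} (hx : |x| < 1) :
    Summable fun n => a n * x ^ n := by
  have h1 := summable_pow_mul_geometric_of_norm_lt_one 1 (r := |x|) (by simpa using hx)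
  have h0 := summable_geometric_of_lt_one (abs_nonneg x) hx
  refine Summable.of_norm_bounded (h1.add h0) fun n => ?_
  rw [norm_mul, norm_pow, Real.norm_eq_abs, Real.norm_eq_abs, pow_one, ← add_one_mul]
  exact mul_le_mul_of_nonneg_right (ha n) (by positivity)

theorem hasDerivAt_tsum_div_mul_pow {a : ℕ → ℝ} (ha : ∀ n, |a n| ≤ n + 1) {x : ℝ}
    (hx : |x| < 1) :
    HasDerivAt (fun y => ∑' n : ℕ, a n / ((n : ℝ) + 1) * y ^ (n + 1)) (∑' n, a n * x ^ n) x := by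
  -- On the ball of radius `r < 1` the differentiated series has a summable majorant independent of
  -- the point.
  obtain ⟨r, hxr, hr1⟩ := exists_between hx
  have hr0 : 0 < r := (abs_nonneg x).trans_lt hxr
  have hs : Summable fun n : ℕ => ((n : ℝ) + 1) * r ^ n :=
    summable_mul_pow_of_abs_le (fun n => (abs_of_nonneg (by positivity)).le)
      (by rwa [abs_of_pos hr0])
  refine hasDerivAt_tsum_of_isPreconnected (t := Metric.ball 0 r) (y₀ := 0)
    (g' := fun n y => a n * y ^ n) hs Metric.isOpen_ball
    (convex_ball 0 r).isPreconnected ?_ ?_ (Metric.mem_ball_self hr0) ?_ (by simpa using hxr)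
  · intro n y _
    have h : (n : ℝ) + 1 ≠ 0 := by positivity
    have := (hasDerivAt_pow (n + 1) y).const_mul (a n / ((n : ℝ) + 1))
    refine this.congr_deriv ?_
    push_cast
    rw [← mul_assoc, div_mul_cancel₀ _ h]
  · intro n y hy
    rw [mem_ball_zero_iff, Real.norm_eq_abs] at hy
    rw [norm_mul, norm_pow, Real.norm_eq_abs, Real.norm_eq_abs]
    have := ha n
    gcongr
  · simp

theorem polylog_eq_tsum (p : ℕ) (x : ℝ) :
    polylog (p + 1) x = ∑' n : ℕ, 1 / ((n : ℝ) + 1) ^ p / ((n : ℝ) + 1) * x ^ (n + 1) := by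
  rw [polylog]
  refine tsum_congr fun n => ?_
  push_cast
  rw [pow_succ, div_div]
  ring

theorem polylog_one {x : ℝ} (hx : |x| < 1) : polylog 1 x = -Real.log (1 - x) := by
  rw [polylog, ← (Real.hasSum_pow_div_log_of_abs_lt_one hx).tsum_eq]
  simp

theorem hasDerivAt_polylog_succ (p : ℕ) {x : ℝ} (hx : |x| < 1) (hx0 : x ≠ 0) :
    HasDerivAt (polylog (p + 1)) (polylog p x / x) x := by
  have ha : ∀ n : ℕ, |1 / ((n : ℝ) + 1) ^ p| ≤ n + 1 := fun n => by
    have h : (1 : ℝ) ≤ (n : ℝ) + 1 := by linarith [Nat.cast_nonneg (α := ℝ) n]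
    rw [abs_of_nonneg (by positivity), div_le_iff₀ (by positivity)]
    exact one_le_mul_of_one_le_of_one_le h (one_le_pow₀ h)
  have h := hasDerivAt_tsum_div_mul_pow ha hx
  rw [show polylog (p + 1) = _ from funext (polylog_eq_tsum p)]
  refine h.congr_deriv ?_
  rw [polylog, ← tsum_div_const]
  refine tsum_congr fun n => ?_
  push_cast
  field_simp
  rw [pow_succ]

/-- The generating function `∑ y ^ k₁ (-1) ^ k_{m+1} / (k₁ ⋯ k_{m+1})` over
`k₁ > ⋯ > k_{m+1} ≥ 1`. -/
noncomputable def altGen (m : ℕ) (y : ℝ) : ℝ := ∑' n : ℕ, altCoeff m (n + 1) * y ^ (n + 1)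

theorem summable_altGen (m : ℕ) {y : ℝ} (hy : |y| < 1) :
    Summable fun n : ℕ => altCoeff m (n + 1) * y ^ (n + 1) := by
  have h := summable_mul_pow_of_abs_le (a := fun n => altCoeff m (n + 1))
    (fun n => (abs_altCoeff_le_one m n).trans (by linarith [Nat.cast_nonneg (α := ℝ) n])) hy
  refine (h.mul_right y).congr fun n => ?_
  ring

theorem altGen_zero_right (m : ℕ) : altGen m 0 = 0 := by simp [altGen]

theorem altGen_zero_left {y : ℝ} (hy : |y| < 1) : altGen 0 y = -Real.log (1 + y) := by
  have h := Real.hasSum_pow_div_log_of_abs_lt_one (x := -y) (by simpa using hy)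
  rw [sub_neg_eq_add] at h
  rw [← h.tsum_eq, altGen]
  refine tsum_congr fun n => ?_
  rw [altCoeff, neg_pow y]
  push_cast
  ring

theorem hasDerivAt_altGen_succ (m : ℕ) {y : ℝ} (hy : |y| < 1) :
    HasDerivAt (altGen (m + 1)) (altGen m y / (1 - y)) y := by
  have ha : ∀ n : ℕ, |altSum m n| ≤ (n : ℝ) + 1 := fun n =>
    (abs_altSum_le m n).trans (by linarith)
  have h := hasDerivAt_tsum_div_mul_pow ha hy
  have hs := summable_mul_pow_of_abs_le ha hy
  have e : altGen (m + 1) = fun y => ∑' n : ℕ, altSum m n / ((n : ℝ) + 1) * y ^ (n + 1) := by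
    funext z
    simp only [altGen, altCoeff_succ_succ]
  rw [e]
  refine h.congr_deriv ?_
  have hy1 : 1 - y ≠ 0 := by linarith [(abs_lt.1 hy).2]
  rw [eq_div_iff hy1]
  -- Partial summation of coefficients amounts to dividing the generating function by `1 - y`.
  have e2 : ∑' n, altSum m n * y ^ n = y * ∑' n, altSum m n * y ^ n + altGen m y := by
    conv_lhs => rw [hs.tsum_eq_zero_add]
    rw [altSum_zero_right, zero_mul, zero_add, ← tsum_mul_left, altGen,
      ← (hs.mul_left y).tsum_add (summable_altGen m hy)]
    refine tsum_congr fun n => ?_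
    rw [altSum_succ_right]
    ring
  linarith

/-! ### Closed form in polylogarithms -/

/-- The polylogarithmic closed form of `altGen m (1 - 2 * p)`. -/
noncomputable def altClosed (m : ℕ) (p : ℝ) : ℝ :=
  (-1) ^ m * (polylog (m + 1) p - ∑ j ∈ Finset.range (m + 1),
    polylog (j + 1) (1 / 2) * (Real.log (2 * p) ^ (m - j) / ((m - j).factorial : ℝ)))

theorem polylog_one_half : polylog 1 (1 / 2) = Real.log 2 := by
  rw [polylog_one (by rw [abs_of_pos] <;> norm_num), ← Real.log_inv]
  norm_num

/-- At `p = 1/2` the logarithm vanishes, so only `j = m` survives and cancels the leading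
polylogarithm. This fixes the constants of integration. -/
theorem altClosed_half (m : ℕ) : altClosed m (1 / 2) = 0 := by
  rw [altClosed, Finset.sum_range_succ, Finset.sum_eq_zero]
  · simp
  · intro j hj
    rw [Finset.mem_range] at hj
    simp [Nat.sub_ne_zero_of_lt hj]

theorem altClosed_zero {p : ℝ} (hp : |p| < 1) :
    altClosed 0 p = -Real.log (2 * (1 - p)) := by
  have h : 1 - p ≠ 0 := by linarith [(abs_lt.1 hp).2]
  simp only [altClosed, zero_add, Finset.sum_range_one, polylog_one_half, polylog_one hp,
    Real.log_mul two_ne_zero h]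
  simp
  ring

theorem hasDerivAt_altClosed_succ (m : ℕ) {p : ℝ} (hp0 : 0 < p) (hp1 : p < 1) :
    HasDerivAt (altClosed (m + 1)) (-(altClosed m p / p)) p := by
  have hp : |p| < 1 := by rwa [abs_of_pos hp0]
  have hlog : HasDerivAt (fun p : ℝ => Real.log (2 * p)) (1 / p) p := by
    have := ((hasDerivAt_id p).const_mul 2).log (by simpa using hp0.ne')
    refine this.congr_deriv ?_
    simp
    field_simp
  have hterm : ∀ k : ℕ, HasDerivAt
      (fun p : ℝ => Real.log (2 * p) ^ (k + 1) / ((k + 1).factorial : ℝ))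
      (Real.log (2 * p) ^ k / (k.factorial : ℝ) / p) p := by
    intro k
    refine ((hlog.pow (k + 1)).div_const _).congr_deriv ?_
    rw [Nat.factorial_succ]
    push_cast
    field_simp
  have hsum : HasDerivAt (fun p : ℝ => ∑ j ∈ Finset.range (m + 1 + 1),
      polylog (j + 1) (1 / 2) *
        (Real.log (2 * p) ^ (m + 1 - j) / ((m + 1 - j).factorial : ℝ)))
      (∑ j ∈ Finset.range (m + 1),
        polylog (j + 1) (1 / 2) * (Real.log (2 * p) ^ (m - j) / ((m - j).factorial : ℝ) / p))
      p := by
    have h : HasDerivAt (fun p : ℝ => ∑ j ∈ Finset.range (m + 1),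
        polylog (j + 1) (1 / 2) *
          (Real.log (2 * p) ^ (m + 1 - j) / ((m + 1 - j).factorial : ℝ))) _ p :=
      HasDerivAt.fun_sum fun j hj => by
        have hj' : m + 1 - j = m - j + 1 := by
          have := Finset.mem_range.1 hj
          omega
        rw [hj']
        exact (hterm (m - j)).const_mul _
    have h2 := h.add_const (polylog (m + 1 + 1) (1 / 2))
    refine h2.congr_of_eventuallyEq (Eventually.of_forall fun q => ?_)
    simp [Finset.sum_range_succ _ (m + 1)]
  have h := ((hasDerivAt_polylog_succ (m + 1) hp hp0.ne').sub hsum).const_mul ((-1 : ℝ) ^ (m + 1))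
  refine h.congr_deriv ?_
  rw [altClosed]
  simp only [← mul_div_assoc, ← Finset.sum_div]
  ring

/-- By induction both sides have the same derivative on the interval, and both vanish at `x = 0`,
that is at `p = 1/2`. -/
theorem altGen_neg_eq_altClosed (m : ℕ) {x : ℝ} (hx : x ∈ Set.Ioo (-1 : ℝ) 1) :
    altGen m (-x) = altClosed m ((1 + x) / 2) := by
  induction m generalizing x with
  | zero =>
    have hp : |(1 + x) / 2| < 1 := by
      rw [abs_lt]; constructor <;> linarith [hx.1, hx.2]
    rw [altGen_zero_left (by rw [abs_neg]; exact abs_lt.2 hx), altClosed_zero hp]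
    congr 2
    ring
  | succ m ih =>
    have hd1 : ∀ z ∈ Set.Ioo (-1 : ℝ) 1, HasDerivAt (fun z => altGen (m + 1) (-z))
        (-(altGen m (-z) / (1 + z))) z := by
      intro z hz
      have h := hasDerivAt_altGen_succ m (y := -z) (by rw [abs_neg]; exact abs_lt.2 hz)
      refine (h.comp z (hasDerivAt_neg z)).congr_deriv ?_
      rw [sub_neg_eq_add]
      ring
    have hd2 : ∀ z ∈ Set.Ioo (-1 : ℝ) 1, HasDerivAt (fun z => altClosed (m + 1) ((1 + z) / 2))
        (-(altGen m (-z) / (1 + z))) z := by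
      intro z hz
      have h := hasDerivAt_altClosed_succ m (p := (1 + z) / 2) (by linarith [hz.1])
        (by linarith [hz.2])
      have h2 : HasDerivAt (fun z : ℝ => (1 + z) / 2) (1 / 2) z :=
        ((hasDerivAt_id z).const_add 1).div_const 2
      refine (HasDerivAt.comp z h h2).congr_deriv ?_
      rw [← ih hz]
      have : 1 + z ≠ 0 := by linarith [hz.1]
      field_simp
    refine isOpen_Ioo.eqOn_of_deriv_eq (x := 0) isPreconnected_Ioo
      (fun z hz => (hd1 z hz).differentiableAt.differentiableWithinAt)
      (fun z hz => (hd2 z hz).differentiableAt.differentiableWithinAt)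
      (fun z hz => (hd1 z hz).deriv.trans (hd2 z hz).deriv.symm) (by norm_num) ?_ hx
    simp only [neg_zero, add_zero, altGen_zero_right, altClosed_half]

/-! ### The value of the limit -/

theorem hasSum_zetaNat {p : ℕ} (hp : 2 ≤ p) :
    HasSum (fun n : ℕ => 1 / ((n : ℝ) + 1) ^ p) (zetaNat p) := by
  have hs : Summable fun n : ℕ => 1 / (n : ℝ) ^ p := Real.summable_one_div_nat_pow.2 (by omega)
  have hz : zetaNat p = ∑' n : ℕ, 1 / (n : ℝ) ^ p := by
    have h : (riemannZeta (p : ℂ)) = ((∑' n : ℕ, 1 / (n : ℝ) ^ p : ℝ) : ℂ) := by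
      rw [zeta_nat_eq_tsum_of_gt_one (by omega)]
      push_cast
      rfl
    rw [zetaNat, h, Complex.ofReal_re]
  rw [hz, hs.tsum_eq_zero_add]
  have h := ((summable_nat_add_iff 1).2 hs).hasSum
  have h0 : (0 : ℕ) ≠ p := by omega
  simpa [h0.symm] using h

theorem tendsto_polylog_one {p : ℕ} (hp : 2 ≤ p) :
    Tendsto (polylog p) (𝓝[<] 1) (𝓝 (zetaNat p)) := by
  have h := Real.tendsto_tsum_powerSeries_nhdsWithin_lt (hasSum_zetaNat hp).tendsto_sum_nat
  have hx : Tendsto (fun x : ℝ => x) (𝓝[<] 1) (𝓝 1) := tendsto_nhdsWithin_of_tendsto_nhds tendsto_id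
  have := hx.mul h
  rw [one_mul] at this
  refine this.congr fun x => ?_
  rw [polylog, ← tsum_mul_left]
  refine tsum_congr fun n => ?_
  push_cast
  ring

/-- The closed form of `ζ(1̄, {1}_{m-1}, 1̄)`. -/
noncomputable def barOnesBarValue (m : ℕ) : ℝ :=
  (-1) ^ m * (zetaNat (m + 1) - ∑ j ∈ Finset.range (m + 1),
    polylog (j + 1) (1 / 2) * (Real.log 2 ^ (m - j) / ((m - j).factorial : ℝ)))

theorem tendsto_altClosed_one {m : ℕ} (hm : 1 ≤ m) :
    Tendsto (altClosed m) (𝓝[<] 1) (𝓝 (barOnesBarValue m)) := by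
  refine ((tendsto_polylog_one (by omega)).sub ?_).const_mul _
  refine tendsto_nhdsWithin_of_tendsto_nhds ?_
  have h : ContinuousAt (fun p : ℝ => ∑ j ∈ Finset.range (m + 1),
      polylog (j + 1) (1 / 2) * (Real.log (2 * p) ^ (m - j) / ((m - j).factorial : ℝ))) 1 := by
    have hl : ContinuousAt (fun p : ℝ => Real.log (2 * p)) 1 :=
      (continuousAt_const.mul continuousAt_id).log (by norm_num)
    exact tendsto_finsetSum _ fun j _ => ((hl.pow _).div_const _).const_mul _
  simpa [ContinuousAt] using h

theorem tendsto_sum_altCoeff (m : ℕ) :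
    Tendsto (fun n => ∑ k ∈ Finset.range n, (-1) ^ k * altCoeff (m + 1) k) atTop
      (𝓝 (barOnesBarValue (m + 1))) := by
  -- Abel's theorem presupposes convergence; the value of `l` is then read off from the closed form
  -- as `x` tends to 1 from below.
  obtain ⟨l, hl⟩ := exists_tendsto_sum_altCoeff m
  have h1 := Real.tendsto_tsum_powerSeries_nhdsWithin_lt hl
  have hp : Tendsto (fun x : ℝ => (1 + x) / 2) (𝓝[<] 1) (𝓝[<] 1) := by
    refine tendsto_nhdsWithin_of_tendsto_nhds_of_eventually_within _
      (tendsto_nhdsWithin_of_tendsto_nhds ?_) ?_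
    · have : ContinuousAt (fun x : ℝ => (1 + x) / 2) 1 := by fun_prop
      simpa [ContinuousAt, one_add_one_eq_two] using this
    · filter_upwards [self_mem_nhdsWithin] with x hx
      simp only [Set.mem_Iio] at hx ⊢
      linarith
  have h2 := (tendsto_altClosed_one (m := m + 1) (by omega)).comp hp
  have h3 : (fun x : ℝ => ∑' n, (-1) ^ n * altCoeff (m + 1) n * x ^ n) =ᶠ[𝓝[<] 1]
      (altClosed (m + 1) ∘ fun x : ℝ => (1 + x) / 2) := by
    filter_upwards [Ioo_mem_nhdsLT (show (-1 : ℝ) < 1 by norm_num)] with x hx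
    have hs : Summable fun n : ℕ => (-1) ^ n * altCoeff (m + 1) n * x ^ n := by
      rw [← summable_nat_add_iff 1]
      refine (summable_altGen (m + 1) (y := -x) (by rw [abs_neg]; exact abs_lt.2 hx)).congr
        fun n => ?_
      rw [neg_pow x]
      ring
    rw [Function.comp_apply, ← altGen_neg_eq_altClosed _ hx, altGen, hs.tsum_eq_zero_add]
    have h0 : altCoeff (m + 1) 0 = 0 := by simp [altCoeff]
    rw [h0, mul_zero, zero_mul, zero_add]
    refine tsum_congr fun n => ?_
    rw [neg_pow x]
    ring
  rwa [tendsto_nhds_unique (h1.congr' h3) h2] at hl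

theorem tendsto_multipleHarmonic_barOnesBar (m : ℕ) :
    Tendsto (multipleHarmonic (barOnesBar m)) atTop (𝓝 (barOnesBarValue (m + 1))) :=
  (((tendsto_add_atTop_iff_nat 1).2 (tendsto_sum_altCoeff m))).congr fun n =>
    (multipleHarmonic_barOnesBar m n).symm

theorem multipleZeta_barOnesBar (m : ℕ) :
    multipleZeta (barOnesBar m) = barOnesBarValue (m + 1) :=
  (tendsto_multipleHarmonic_barOnesBar m).limUnder_eq

/-! ### The initial value -/

/-- The value of `ζ(1̄)`, as a limit of partial sums. -/
theorem tendsto_altSum_zero : Tendsto (altSum 0) atTop (𝓝 (-Real.log 2)) := by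
  have hb : Tendsto (fun n : ℕ => 1 / ((n : ℝ) + 1)) atTop (𝓝 0) :=
    tendsto_one_div_add_atTop_nhds_zero_nat
  have hv : Summable fun n : ℕ => |1 / ((n : ℝ) + 1) - 1 / (((n + 1 : ℕ) : ℝ) + 1)| := by
    refine Summable.of_nonneg_of_le (fun _ => abs_nonneg _) (fun n => ?_)
      (hasSum_zetaNat le_rfl).summable
    have h : (0 : ℝ) < (n : ℝ) + 1 := by positivity
    push_cast
    have e : 1 / ((n : ℝ) + 1) - 1 / ((n : ℝ) + 1 + 1) = 1 / (((n : ℝ) + 1) * ((n : ℝ) + 1 + 1)) := by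
      field_simp
      ring
    rw [e, abs_of_pos (by positivity)]
    gcongr
    nlinarith
  obtain ⟨l, hl⟩ := tendsto_sum_neg_one_pow_mul hb hv
  have h1 := Real.tendsto_tsum_powerSeries_nhdsWithin_lt hl
  have hx : Tendsto (fun x : ℝ => x) (𝓝[<] 1) (𝓝 1) := tendsto_nhdsWithin_of_tendsto_nhds tendsto_id
  have h2 : Tendsto (fun x : ℝ => Real.log (1 + x)) (𝓝[<] 1) (𝓝 (Real.log (1 + 1))) :=
    (hx.const_add 1).log (by norm_num)
  have h3 : (fun x : ℝ => x * ∑' n : ℕ, (-1) ^ n * (1 / ((n : ℝ) + 1)) * x ^ n) =ᶠ[𝓝[<] 1]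
      fun x => Real.log (1 + x) := by
    filter_upwards [Ioo_mem_nhdsLT (show (-1 : ℝ) < 1 by norm_num)] with x hx
    have := altGen_zero_left (abs_lt.2 hx)
    rw [← neg_eq_iff_eq_neg] at this
    rw [← this, altGen, ← tsum_mul_left, ← tsum_neg]
    refine tsum_congr fun n => ?_
    simp only [altCoeff]
    push_cast
    ring
  have h4 := tendsto_nhds_unique ((hx.mul h1).congr' h3) h2
  rw [one_mul, one_add_one_eq_two] at h4
  rw [← h4]
  refine hl.neg.congr fun n => ?_
  rw [altSum_eq_sum, Finset.range_eq_Ico, ← Finset.sum_neg_distrib]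
  have : Finset.Icc 1 n = Finset.Ico (0 + 1) (n + 1) := by ext; simp
  rw [this, ← Finset.sum_Ico_add' _ 0 n 1]
  refine Finset.sum_congr rfl fun k _ => ?_
  simp only [altCoeff]
  push_cast
  ring

/-- Stuffle product: in the square of `ζ_n(1̄)` the off-diagonal terms count `ζ_n(1̄, 1̄)` twice,
and on the diagonal the signs cancel. Passing to the limit here avoids evaluating `Li_2(1/2)`. -/
theorem multipleHarmonic_barOnesBar_zero (n : ℕ) :
    multipleHarmonic (barOnesBar 0) n =
      (altSum 0 n ^ 2 - ∑ k ∈ Finset.range n, 1 / ((k : ℝ) + 1) ^ 2) / 2 := by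
  rw [multipleHarmonic_barOnesBar]
  induction n with
  | zero => simp [altCoeff, altSum_zero_right]
  | succ n ih =>
    rw [Finset.sum_range_succ, ih, altSum_succ_right, Finset.sum_range_succ, altCoeff_succ_succ]
    have h : ((-1 : ℝ) ^ (n + 1)) ^ 2 = 1 := by rw [← pow_mul, mul_comm, pow_mul]; simp
    have h' : (n : ℝ) + 1 ≠ 0 := by positivity
    simp only [altCoeff]
    push_cast
    field_simp
    linear_combination (-1 : ℝ) * h

theorem multipleZeta_barOnesBar_zero :
    multipleZeta (barOnesBar 0) = (Real.log 2 ^ 2 - zetaNat 2) / 2 := by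
  refine Tendsto.limUnder_eq ?_
  have h := ((tendsto_altSum_zero.pow 2).sub (hasSum_zetaNat le_rfl).tendsto_sum_nat).div_const 2
  rw [neg_sq] at h
  exact h.congr fun n => (multipleHarmonic_barOnesBar_zero n).symm

/-! ### The recurrence -/

theorem sum_range_neg_one_pow_div_factorial {n : ℕ} (hn : 1 ≤ n) :
    ∑ k ∈ Finset.range (n + 1), (-1 : ℝ) ^ k / ((n - k).factorial * k.factorial) = 0 := by
  have h := Int.alternating_sum_range_choose_of_ne (n := n) (by omega)
  have h' : ∑ k ∈ Finset.range (n + 1), (-1 : ℝ) ^ k * (n.choose k : ℝ) = 0 := by exact_mod_cast h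
  have e : ∀ k ∈ Finset.range (n + 1), (-1 : ℝ) ^ k / ((n - k).factorial * k.factorial) =
      (-1 : ℝ) ^ k * (n.choose k : ℝ) / n.factorial := by
    intro k hk
    rw [Nat.cast_choose ℝ (by simpa [Nat.lt_succ_iff] using hk)]
    have : (n.factorial : ℝ) ≠ 0 := by positivity
    field_simp
  rw [Finset.sum_congr rfl e, ← Finset.sum_div, h', zero_div]

theorem sum_range_neg_one_pow_div_factorial_succ (n : ℕ) :
    ∑ k ∈ Finset.range (n + 1), (-1 : ℝ) ^ k / ((n - k).factorial * (k + 1).factorial) =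
      1 / (n + 1).factorial := by
  have h := sum_range_neg_one_pow_div_factorial (n := n + 1) (by omega)
  -- The shifted sum is the vanishing sum for `n + 1` with its `k = 0` term moved to the other side.
  rw [Finset.sum_range_succ'] at h
  simp only [Nat.add_sub_add_right, pow_succ, mul_neg_one, neg_div, Finset.sum_neg_distrib] at h
  simp at h
  rw [one_div]
  linarith

/-- The values `(-1) ^ m * (z m - ∑ A j * L ^ (m - j) / (m - j)!)` satisfy the recurrence. -/
theorem sum_range_recurrence (A z : ℕ → ℝ) (L : ℝ) {n : ℕ} (hn : 1 ≤ n) :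
    ∑ k ∈ Finset.range (n + 1), L ^ (n - k) / ((n - k).factorial : ℝ) *
        ((-1) ^ (k + 1) * (z (k + 1) - ∑ j ∈ Finset.range (k + 2),
          A j * (L ^ (k + 1 - j) / ((k + 1 - j).factorial : ℝ)))) =
      A 0 * L ^ (n + 1) / ((n + 1).factorial : ℝ)
      - z 1 * L ^ n / (n.factorial : ℝ)
      - 1 / (n.factorial : ℝ) * ∑ k ∈ Finset.Icc 1 n, (n.choose k : ℝ) * (-1 : ℝ) ^ (k + 1) *
          ((∑ l ∈ Finset.Icc 1 k, (l.factorial : ℝ) * (k.choose l : ℝ) * L ^ (n - l) * A (l + 1))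
            - (k.factorial : ℝ) * L ^ (n - k) * z (k + 1)) := by
  have hn0 : (n.factorial : ℝ) ≠ 0 := by positivity
  have hinner : ∀ k, ∀ g : ℕ → ℝ, ∑ l ∈ Finset.Icc 1 k, g l = ∑ l ∈ Finset.range k, g (l + 1) := by
    intro k g
    rw [Finset.range_eq_Ico, Finset.sum_Ico_add' g 0 k 1]
    refine Finset.sum_congr ?_ fun _ _ => rfl
    ext
    simp
  set T : ℕ → ℝ := fun k => (n.choose k : ℝ) * (-1 : ℝ) ^ (k + 1) *
    ((∑ l ∈ Finset.Icc 1 k, (l.factorial : ℝ) * (k.choose l : ℝ) * L ^ (n - l) * A (l + 1))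
      - (k.factorial : ℝ) * L ^ (n - k) * z (k + 1)) with hT
  have hT0 : ∑ k ∈ Finset.Icc 1 n, T k = ∑ k ∈ Finset.range (n + 1), T k - L ^ n * z 1 := by
    rw [Finset.sum_range_succ', hinner]
    simp [hT]
  -- The terms `j = 0` and `j = 1` are split off: summed over `k`, the first gives `1 / (n + 1)!`
  -- and the second vanishes. The terms `j ≥ 2` together with `z` form `T k`.
  have hterm : ∀ k ∈ Finset.range (n + 1), L ^ (n - k) / ((n - k).factorial : ℝ) *
        ((-1) ^ (k + 1) * (z (k + 1) - ∑ j ∈ Finset.range (k + 2),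
          A j * (L ^ (k + 1 - j) / ((k + 1 - j).factorial : ℝ)))) =
      A 0 * L ^ (n + 1) * ((-1 : ℝ) ^ k / ((n - k).factorial * (k + 1).factorial))
      + A 1 * L ^ n * ((-1 : ℝ) ^ k / ((n - k).factorial * k.factorial))
      - 1 / (n.factorial : ℝ) * T k := by
    intro k hk
    have hk' : k ≤ n := by simpa [Nat.lt_succ_iff] using hk
    obtain ⟨d, rfl⟩ := Nat.exists_eq_add_of_le hk'
    have hsum : ∑ l ∈ Finset.Icc 1 k, (l.factorial : ℝ) * (k.choose l : ℝ) * L ^ (k + d - l) *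
        A (l + 1) = k.factorial * L ^ d *
          ∑ l ∈ Finset.range k, A (l + 2) * (L ^ (k - 1 - l) / ((k - 1 - l).factorial : ℝ)) := by
      rw [hinner, Finset.mul_sum]
      refine Finset.sum_congr rfl fun l hl => ?_
      obtain ⟨e, rfl⟩ := Nat.exists_eq_add_of_le (Nat.succ_le_of_lt (Finset.mem_range.1 hl))
      rw [Nat.cast_choose ℝ (by omega), show l.succ + e + d - (l + 1) = d + e by omega,
        show l.succ + e - (l + 1) = e by omega, show l.succ + e - 1 - l = e by omega]
      field_simp
      ring
    simp only [hT]
    rw [hsum, Finset.sum_range_succ', Finset.sum_range_succ', Nat.cast_choose ℝ hk',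
      Nat.add_sub_cancel_left]
    have e : ∀ l, k + 1 - (l + 1 + 1) = k - 1 - l := fun l => by omega
    simp only [e, zero_add, Nat.sub_zero, Nat.add_sub_cancel]
    set S := ∑ l ∈ Finset.range k, A (l + 1 + 1) * (L ^ (k - 1 - l) / ((k - 1 - l).factorial : ℝ))
    have h1 : ((k + 1).factorial : ℝ) ≠ 0 := by positivity
    field_simp
    ring
  rw [Finset.sum_congr rfl hterm, Finset.sum_sub_distrib, Finset.sum_add_distrib,
    ← Finset.mul_sum, ← Finset.mul_sum, ← Finset.mul_sum, hT0,
    sum_range_neg_one_pow_div_factorial hn, sum_range_neg_one_pow_div_factorial_succ]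
  ring

theorem barOnesBarValue_recurrence {n : ℕ} (hn : 1 ≤ n) :
    ∑ k ∈ Finset.range (n + 1), Real.log 2 ^ (n - k) / ((n - k).factorial : ℝ) *
        barOnesBarValue (k + 1) =
      Real.log 2 ^ (n + 2) / ((n + 1).factorial : ℝ)
      - zetaNat 2 * Real.log 2 ^ n / (n.factorial : ℝ)
      - 1 / (n.factorial : ℝ) * ∑ k ∈ Finset.Icc 1 n, (n.choose k : ℝ) * (-1 : ℝ) ^ (k + 1) *
          ((∑ l ∈ Finset.Icc 1 k, (l.factorial : ℝ) * (k.choose l : ℝ) * Real.log 2 ^ (n - l) *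
              polylog (l + 2) (1 / 2))
            - (k.factorial : ℝ) * Real.log 2 ^ (n - k) * zetaNat (k + 2)) := by
  have h := sum_range_recurrence (fun j => polylog (j + 1) (1 / 2)) (fun j => zetaNat (j + 1))
    (Real.log 2) hn
  simp only [zero_add, polylog_one_half, ← pow_succ'] at h
  exact h

/-- Membership is read off the closed form, without induction along the recurrence; the term `j = 0`
is `Li_1(1/2) = ln 2`. -/
theorem barOnesBarValue_mem_adjoin (m : ℕ) (hm : 1 ≤ m) :
    barOnesBarValue m ∈ Algebra.adjoin ℚ
      ({Real.log 2} ∪ {x : ℝ | ∃ j : ℕ, 2 ≤ j ∧ j ≤ m + 1 ∧ x = zetaNat j} ∪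
        {x : ℝ | ∃ j : ℕ, 2 ≤ j ∧ j ≤ m + 1 ∧ x = polylog j (1 / 2)}) := by
  set S := ({Real.log 2} ∪ {x : ℝ | ∃ j : ℕ, 2 ≤ j ∧ j ≤ m + 1 ∧ x = zetaNat j} ∪
    {x : ℝ | ∃ j : ℕ, 2 ≤ j ∧ j ≤ m + 1 ∧ x = polylog j (1 / 2)})
  have hlog : Real.log 2 ∈ Algebra.adjoin ℚ S := Algebra.subset_adjoin (Or.inl (Or.inl rfl))
  refine mul_mem (pow_mem (neg_mem (one_mem _)) _) (sub_mem ?_ (sum_mem fun j hj => mul_mem ?_ ?_))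
  · exact Algebra.subset_adjoin (Or.inl (Or.inr ⟨m + 1, by omega, le_rfl, rfl⟩))
  · rcases Nat.eq_zero_or_pos j with rfl | h
    · rwa [zero_add, polylog_one_half]
    · have := Finset.mem_range.1 hj
      exact Algebra.subset_adjoin (Or.inr ⟨j + 1, by omega, by omega, rfl⟩)
  · rw [div_eq_mul_inv]
    refine mul_mem (pow_mem hlog _) ?_
    have := (Algebra.adjoin ℚ S).algebraMap_mem (((m - j).factorial : ℚ)⁻¹)
    simpa using this

theorem corollary4p1 :
    -- each value `ζ(1̄, {1}_{m-1}, 1̄)` exists, as a limit of multiple harmonic numbers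
    (∀ m : ℕ, 1 ≤ m →
      Tendsto (multipleHarmonic (barOnesBar (m - 1))) atTop
        (𝓝 (multipleZeta (barOnesBar (m - 1))))) ∧
    -- the initial value `ζ(1̄, 1̄)`
    multipleZeta (barOnesBar 0) = (Real.log 2 ^ 2 - zetaNat 2) / 2 ∧
    -- the recurrence
    (∀ m : ℕ, 2 ≤ m →
      multipleZeta (barOnesBar (m - 1)) =
        1 / (m.factorial : ℝ) * Real.log 2 ^ (m + 1)
        - zetaNat 2 * Real.log 2 ^ (m - 1) / ((m - 1).factorial : ℝ)
        - ∑ i ∈ Finset.Icc 1 (m - 1),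
            Real.log 2 ^ i / (i.factorial : ℝ) * multipleZeta (barOnesBar (m - i - 1))
        - 1 / ((m - 1).factorial : ℝ) *
            ∑ k ∈ Finset.Icc 1 (m - 1),
              ((m - 1).choose k : ℝ) * (-1 : ℝ) ^ (k + 1) *
                ((∑ l ∈ Finset.Icc 1 k,
                    (l.factorial : ℝ) * (k.choose l : ℝ) * Real.log 2 ^ (m - l - 1) *
                      polylog (l + 2) (1 / 2))
                  - (k.factorial : ℝ) * Real.log 2 ^ (m - k - 1) * zetaNat (k + 2))) ∧
    -- hence each value is a rational polynomial in `ln 2`, zeta values and polylogarithms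
    (∀ m : ℕ, 1 ≤ m →
      multipleZeta (barOnesBar (m - 1)) ∈
        Algebra.adjoin ℚ
          ({Real.log 2} ∪ {x : ℝ | ∃ j : ℕ, 2 ≤ j ∧ j ≤ m + 1 ∧ x = zetaNat j} ∪
            {x : ℝ | ∃ j : ℕ, 2 ≤ j ∧ j ≤ m + 1 ∧ x = polylog j (1 / 2)})) := by
  refine ⟨fun m _ => ?_, multipleZeta_barOnesBar_zero, fun m hm => ?_, fun m hm => ?_⟩
  · rw [multipleZeta_barOnesBar]
    exact tendsto_multipleHarmonic_barOnesBar (m - 1)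
  · obtain ⟨n, rfl⟩ : ∃ n, m = n + 1 := ⟨m - 1, by omega⟩
    have h := barOnesBarValue_recurrence (n := n) (by omega)
    -- Reversal makes `i = n - k` the index; the split-off term `i = 0` is the value being solved
    -- for.
    rw [← Finset.sum_range_reflect, Finset.sum_range_succ'] at h
    have e : ∑ i ∈ Finset.Icc 1 n,
          Real.log 2 ^ i / (i.factorial : ℝ) * multipleZeta (barOnesBar (n + 1 - i - 1)) =
        ∑ i ∈ Finset.range n, Real.log 2 ^ (n - (n + 1 - 1 - (i + 1))) /
          ((n - (n + 1 - 1 - (i + 1))).factorial : ℝ) *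
            barOnesBarValue (n + 1 - 1 - (i + 1) + 1) := by
      have hI : Finset.Icc 1 n = Finset.Ico (0 + 1) (n + 1) := by ext; simp
      rw [hI, ← Finset.sum_Ico_add' _ 0 n 1, ← Finset.range_eq_Ico]
      refine Finset.sum_congr rfl fun i hi => ?_
      have := Finset.mem_range.1 hi
      rw [multipleZeta_barOnesBar, show n - (n + 1 - 1 - (i + 1)) = i + 1 by omega,
        show n + 1 - (i + 1) - 1 = n + 1 - 1 - (i + 1) by omega]
    rw [← e] at h
    have hexp : ∀ l, n + 1 - l - 1 = n - l := fun l => by omega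
    simp only [Nat.add_sub_cancel, Nat.sub_zero, Nat.sub_self, pow_zero, Nat.factorial_zero,
      Nat.cast_one, div_one, one_mul, hexp] at h ⊢
    rw [multipleZeta_barOnesBar]
    linear_combination h
  · rw [multipleZeta_barOnesBar, Nat.sub_add_cancel hm]
    exact barOnesBarValue_mem_adjoin m hm
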